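/- For a triangulated category $\mathcal T$ let $\mathcal T^{\sim}$ be its idempotent completion, with the induced shift and with the direct summands of distinguished triangles of $\mathcal T$ as distinguished triangles. $K_0(\mathcal T^{\sim})$ is the abelian group generated by the objects of $\mathcal T^{\sim}$ with a relation $[Y]=[X]+[Z]$ for each distinguished triangle $X\to Y\to Z\to X[1]$. (i) Let $\mathcal T$ be an essentially small triangulated category. If $K_0(\mathcal T^{\sim})=0$, then $\mathcal T$ is idempotent complete. (ii) Let $\mathbf E=(\mathcal E,w)$ be an essentially small idempotent complete exact category $\mathcal E$ with a class $w$ of weak equivalences, i.e. a class of morphisms that contains all isomorphisms, satisfies the two-out-of-three property, is closed under retracts, and is closed under extensions: for every morphism of conflations with outer components in $w$, the middle component is in $w$. (This includes every complicial exact category with weak equivalences whose underlying exact category is essentially small and idempotent complete, and the case where $w$ is the class of isomorphisms.) Let $\mathcal E^w$ be the full subcategory of objects $x$ with $0\to x$ in $w$. Let $\mathcal D(\mathcal E)$ be the unbounded derived category of $\mathcal E$, i.e. the Verdier quotient of the homotopy category of unbounded cochain complexes in $\mathcal E$ by the acyclic complexes. Call a complex $w$-acyclic if it becomes zero in the Verdier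 quotient of $\mathcal D(\mathcal E)$ by the thick subcategory generated by the bounded complexes of objects of $\mathcal E^w$, and let $\mathcal D(\mathbf E)$ be the Verdier quotient of the homotopy category of unbounded complexes in $\mathcal E$ by the $w$-acyclic complexes. Then $\mathcal D(\mathbf E)$ is idempotent complete if and only if $K_0(\mathcal D(\mathbf E)^{\sim})=0$. -/

import Mathlib

open CategoryTheory CategoryTheory.Limits CategoryTheory.Pretriangulated

universe w₁ w₂ v₁ v₂ u₁ u₂

noncomputable section

namespace HigherDerived

/-! ### The idempotent completion of a triangulated category and its Grothendieck group -/

section IdempotentCompletion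

variable (T : Type u₁) [Category.{v₁} T] [Preadditive T] [HasShift T ℤ]

/-- The shift on the idempotent completion `Karoubi T`, given on objects by
`(X, p)⟦n⟧ = (X⟦n⟧, p⟦n⟧)` and on morphisms by `f ↦ f⟦n⟧`. -/
instance karoubiHasShift : HasShift (Idempotents.Karoubi T) ℤ :=
  HasShift.induced (Idempotents.toKaroubi T) ℤ
    (fun n => (Idempotents.functorExtension₂ T T).obj (shiftFunctor T n))
    (fun n => (Idempotents.functorExtension₂CompWhiskeringLeftToKaroubiIso T T).app
      (shiftFunctor T n))

/-- The embedding of `T` in its idempotent completion commutes with the shift. -/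
instance toKaroubiCommShift : (Idempotents.toKaroubi T).CommShift ℤ :=
  Functor.CommShift.ofInduced (Idempotents.toKaroubi T) ℤ
    (fun n => (Idempotents.functorExtension₂ T T).obj (shiftFunctor T n))
    (fun n => (Idempotents.functorExtension₂CompWhiskeringLeftToKaroubiIso T T).app
      (shiftFunctor T n))

variable [HasZeroObject T] [∀ n : ℤ, (shiftFunctor T n).Additive] [Pretriangulated T]

/-- The distinguished triangles of the idempotent completion of a triangulated category:
the triangles which are direct summands (that is, retracts) of the
image of a distinguished triangle of `T`. -/
def karoubiDistTriang : Set (Triangle (Idempotents.Karoubi T)) :=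
  {S | ∃ R : Triangle T, R ∈ distTriang T ∧
    Nonempty (Retract S ((Idempotents.toKaroubi T).mapTriangle.obj R))}

end IdempotentCompletion

/-- The relations `[Y] - [X] - [Z]`, one for each distinguished triangle `X ⟶ Y ⟶ Z ⟶ X⟦1⟧`. -/
def k0Relations (C : Type u₁) [Category.{v₁} C] [HasShift C ℤ] (dist : Set (Triangle C)) :
    AddSubgroup (FreeAbelianGroup C) :=
  AddSubgroup.closure {r | ∃ S ∈ dist, r =
    FreeAbelianGroup.of S.obj₂ - FreeAbelianGroup.of S.obj₁ - FreeAbelianGroup.of S.obj₃}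

/-- The Grothendieck group of a category with shift and a class of distinguished triangles: the
abelian group generated by the objects, with `[Y] = [X] + [Z]` for each distinguished
triangle `X ⟶ Y ⟶ Z ⟶ X⟦1⟧`. -/
abbrev K0 (C : Type u₁) [Category.{v₁} C] [HasShift C ℤ] (dist : Set (Triangle C)) : Type u₁ :=
  FreeAbelianGroup C ⧸ k0Relations C dist

/-- The Grothendieck group of the idempotent completion of a triangulated category. -/
abbrev K0Completion (T : Type u₁) [Category.{v₁} T] [Preadditive T] [HasZeroObject T]
    [HasShift T ℤ] [∀ n : ℤ, (shiftFunctor T n).Additive] [Pretriangulated T] :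
    Type (max u₁ v₁) :=
  K0 (Idempotents.Karoubi T) (karoubiDistTriang T)

/-! ### Verdier quotients -/

section Verdier

open scoped ZeroObject

variable {T : Type u₁} [Category.{v₁} T] [Preadditive T] [HasZeroObject T] [HasShift T ℤ]
  [∀ n : ℤ, (shiftFunctor T n).Additive] [Pretriangulated T] [IsTriangulated T]

/-- The thick triangulated subcategory generated by a class of objects `P`: the smallest full
triangulated subcategory closed under direct summands and containing `P`. The zero
objects are added so that the empty class generates the zero subcategory. -/
def thickClosure (P : ObjectProperty T) : ObjectProperty T :=
  ObjectProperty.triangEnvelope (fun A => P A ∨ IsZero A)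

instance thickClosure_isTriangulated (P : ObjectProperty T) :
    (thickClosure P).IsTriangulated := by
  have : ObjectProperty.Nonempty (fun A : T => P A ∨ IsZero A) :=
    ⟨⟨0, Or.inr (isZero_zero T)⟩⟩
  unfold thickClosure
  infer_instance

/-- The Verdier quotient of a triangulated category by the thick subcategory generated by a
class of objects `P`: the localization at the morphisms whose cone lies in that subcategory. -/
abbrev Verdier (P : ObjectProperty T) : Type u₁ := (thickClosure P).trW.Localization

/-- The quotient functor. -/
abbrev verdierQ (P : ObjectProperty T) : T ⥤ Verdier P := (thickClosure P).trW.Q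

end Verdier

/-! ### Exact categories -/

section Exact

open scoped ZeroObject

variable (E : Type u₂) [Category.{v₂} E] [Preadditive E] [HasZeroObject E]
  [HasBinaryBiproducts E]

/-- `i` is the first map of a sequence of the class `conf`. -/
def IsInflation {E : Type u₂} [Category.{v₂} E] [Preadditive E]
    (conf : ObjectProperty (ShortComplex E)) {X Y : E} (i : X ⟶ Y) : Prop :=
  ∃ (Z : E) (p : Y ⟶ Z) (h : i ≫ p = 0), conf (ShortComplex.mk i p h)

/-- `p` is the second map of a sequence of the class `conf`. -/
def IsDeflation {E : Type u₂} [Category.{v₂} E] [Preadditive E]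
    (conf : ObjectProperty (ShortComplex E)) {Y Z : E} (p : Y ⟶ Z) : Prop :=
  ∃ (X : E) (i : X ⟶ Y) (h : i ≫ p = 0), conf (ShortComplex.mk i p h)

/-- A (Quillen) exact structure on an additive category. -/
structure ExactStructure where
  /-- the class of conflations `X ↣ Y ↠ Z` -/
  conflation : ObjectProperty (ShortComplex E)
  of_iso : ∀ {S S' : ShortComplex E}, (S ≅ S') → conflation S → conflation S'
  isKernel : ∀ S : ShortComplex E, conflation S → Nonempty (IsLimit (KernelFork.ofι S.f S.zero))
  isCokernel : ∀ S : ShortComplex E, conflation S →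
    Nonempty (IsColimit (CokernelCofork.ofπ S.g S.zero))
  inflation_id : ∀ X : E, IsInflation conflation (𝟙 X)
  deflation_id : ∀ X : E, IsDeflation conflation (𝟙 X)
  inflation_comp : ∀ {X Y Z : E} (i : X ⟶ Y) (j : Y ⟶ Z), IsInflation conflation i →
    IsInflation conflation j → IsInflation conflation (i ≫ j)
  deflation_comp : ∀ {X Y Z : E} (p : X ⟶ Y) (q : Y ⟶ Z), IsDeflation conflation p →
    IsDeflation conflation q → IsDeflation conflation (p ≫ q)
  inflation_pushout : ∀ {X Y X' : E} (i : X ⟶ Y) (f : X ⟶ X'), IsInflation conflation i →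
    ∃ (Y' : E) (g : Y ⟶ Y') (i' : X' ⟶ Y'), IsPushout i f g i' ∧ IsInflation conflation i'
  deflation_pullback : ∀ {Y Z Z' : E} (p : Y ⟶ Z) (f : Z' ⟶ Z), IsDeflation conflation p →
    ∃ (Y' : E) (g : Y' ⟶ Y) (p' : Y' ⟶ Z'), IsPullback g p' p f ∧ IsDeflation conflation p'

variable {E}

/-- A class of weak equivalences in an exact category: it contains the isomorphisms, has the
two out of three property, and is closed under extensions and under retracts. -/
structure IsWeakEquivalenceClass (X : ExactStructure E) (w : MorphismProperty E) : Prop where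
  of_isIso : MorphismProperty.isomorphisms E ≤ w
  two_out_of_three : w.HasTwoOutOfThreeProperty
  extension : ∀ {S S' : ShortComplex E} (φ : S ⟶ S'), X.conflation S → X.conflation S' →
    w φ.τ₁ → w φ.τ₃ → w φ.τ₂
  retract : w.IsStableUnderRetracts

/-- The `w`-trivial objects: those `A` for which `0 ⟶ A` is in `w`. -/
def wTrivial (w : MorphismProperty E) : ObjectProperty E :=
  fun A => w (0 : (0 : E) ⟶ A)

/-! ### The derived category of an exact category -/

variable (E) in
/-- The homotopy category of unbounded cochain complexes. -/
abbrev KCat : Type (max u₂ v₂) := HomotopyCategory E (ComplexShape.up ℤ)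

/-- A complex `A` is acyclic if each differential factors as a deflation `A n ↠ Z (n+1)` followed
by an inflation `Z (n+1) ↣ A (n+1)`, in such a way that all `Z n ↣ A n ↠ Z (n+1)` are
conflations. -/
def IsAcyclic (X : ExactStructure E) (A : CochainComplex E ℤ) : Prop :=
  ∃ (Z : ℤ → E) (i : ∀ n, Z n ⟶ A.X n) (p : ∀ n, A.X n ⟶ Z (n + 1)) (h : ∀ n, i n ≫ p n = 0),
    (∀ n, X.conflation (ShortComplex.mk (i n) (p n) (h n))) ∧
      ∀ n, p n ≫ i (n + 1) = A.d n (n + 1)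

/-- The acyclic complexes, as objects of the homotopy category. -/
def acyclicK (X : ExactStructure E) : ObjectProperty (KCat E) :=
  fun K => ∃ A : CochainComplex E ℤ, IsAcyclic X A ∧
    Nonempty (K ≅ (HomotopyCategory.quotient E (ComplexShape.up ℤ)).obj A)

/-- The derived category of an exact category: the homotopy category of unbounded complexes modulo
the acyclic complexes. -/
abbrev DExact (X : ExactStructure E) : Type (max u₂ v₂) := Verdier (acyclicK X)

/-- The functor sending a complex to the corresponding object of the derived category. -/
abbrev complexToDExact (X : ExactStructure E) : CochainComplex E ℤ ⥤ DExact X :=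
  HomotopyCategory.quotient E (ComplexShape.up ℤ) ⋙ verdierQ (acyclicK X)

/-- The bounded complexes of `w`-trivial objects. -/
def IsBoundedTrivial (w : MorphismProperty E) (A : CochainComplex E ℤ) : Prop :=
  (∃ a b : ℤ, ∀ n : ℤ, n < a ∨ b < n → IsZero (A.X n)) ∧ ∀ n : ℤ, wTrivial w (A.X n)

/-- The bounded complexes of `w`-trivial objects, as objects of the derived category. -/
def boundedTrivialD (X : ExactStructure E) (w : MorphismProperty E) :
    ObjectProperty (DExact X) :=
  fun K => ∃ A : CochainComplex E ℤ, IsBoundedTrivial w A ∧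
    Nonempty (K ≅ (complexToDExact X).obj A)

/-- The `w`-acyclic complexes: the complexes which become zero in the Verdier quotient of the
derived category of the exact category by the bounded complexes of `w`-trivial objects. This is
the closure of the latter complexes under quasi-isomorphisms. -/
def IsWAcyclic (X : ExactStructure E) (w : MorphismProperty E) (A : CochainComplex E ℤ) : Prop :=
  IsZero ((complexToDExact X ⋙ verdierQ (boundedTrivialD X w)).obj A)

/-- The `w`-acyclic complexes, as objects of the homotopy category. -/
def wAcyclicK (X : ExactStructure E) (w : MorphismProperty E) : ObjectProperty (KCat E) :=
  fun K => ∃ A : CochainComplex E ℤ, IsWAcyclic X w A ∧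
    Nonempty (K ≅ (HomotopyCategory.quotient E (ComplexShape.up ℤ)).obj A)

/-- The derived category of an exact category with weak equivalences: the homotopy category of
unbounded complexes, localized at the quasi-weak equivalences, that is, at the morphisms
whose cone is `w`-acyclic. -/
abbrev DCat (X : ExactStructure E) (w : MorphismProperty E) : Type (max u₂ v₂) :=
  Verdier (wAcyclicK X w)

end Exact
end HigherDerived
end

/-! (i) Call objects of the idempotent completion stably isomorphic if they become isomorphic after
adding objects of `T`. The classes form a group under `⊞`, since an object and its complement add up
to an object of `T`. The key point is `stableClass_additive`: for a summand `A → B → C` of a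
distinguished triangle and complements `A'`, `C'` of the outer terms, `B ⊞ A' ⊞ C'` lies in `T`
(`exists_middle_iso`). So the stable class factors through `K₀`. If `K₀` vanishes, each `A`
satisfies `A ⊞ X ≅ Y` with `X`, `Y` in `T`; then `A` is the cone of a split monomorphism `X → Y`,
hence lies in `T`.

(ii) One direction is (i). For the other, `K₀` of the unbounded homotopy category vanishes by an
Eilenberg swindle (`k0_homotopyCategory_subsingleton`): brutal truncation cuts a complex into two
halves, and for each half `H` the sum `B` of its iterated shifts by `e = ±2` is finite in every
degree, so `B ≅ H ⊞ B⟦e⟧` and `[H] = 0`. The vanishing passes to Verdier quotients, which have the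
same objects up to isomorphism, and then to the completion, which is equivalent to the quotient when
the latter is idempotent complete. -/

noncomputable section

namespace HigherDerived

open Idempotents
open scoped ZeroObject

/-! ### Grothendieck groups -/

section K0

variable {C : Type u₁} [Category.{v₁} C] [HasShift C ℤ] (dist : Set (Triangle C))

/-- The class of an object in the Grothendieck group. -/
def k0Class (A : C) : K0 C dist := QuotientAddGroup.mk (FreeAbelianGroup.of A)

variable {dist}

lemma k0Class_eq_add {S : Triangle C} (hS : S ∈ dist) :
    k0Class dist S.obj₂ = k0Class dist S.obj₁ + k0Class dist S.obj₃ := by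
  have h : FreeAbelianGroup.of S.obj₂ - FreeAbelianGroup.of S.obj₁ - FreeAbelianGroup.of S.obj₃ ∈
      k0Relations C dist := AddSubgroup.subset_closure ⟨S, hS, rfl⟩
  have h' := (QuotientAddGroup.eq_zero_iff _).2 h
  rw [QuotientAddGroup.mk_sub, QuotientAddGroup.mk_sub, sub_sub, sub_eq_zero] at h'
  exact h'

/-- A function on objects which is additive on the given triangles induces a homomorphism on the
Grothendieck group. -/
def k0Lift {G : Type*} [AddCommGroup G] (φ : C → G)
    (hφ : ∀ S ∈ dist, φ S.obj₂ = φ S.obj₁ + φ S.obj₃) : K0 C dist →+ G :=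
  QuotientAddGroup.lift _ (FreeAbelianGroup.lift φ) ((AddSubgroup.closure_le _).2 (by
    rintro _ ⟨S, hS, rfl⟩
    simp [hφ S hS]))

lemma k0Lift_k0Class {G : Type*} [AddCommGroup G] (φ : C → G)
    (hφ : ∀ S ∈ dist, φ S.obj₂ = φ S.obj₁ + φ S.obj₃) (A : C) :
    k0Lift φ hφ (k0Class dist A) = φ A := by
  change FreeAbelianGroup.lift φ (FreeAbelianGroup.of A) = φ A
  simp

lemma k0_subsingleton (h : ∀ A : C, k0Class dist A = 0) : Subsingleton (K0 C dist) := by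
  have hmk : QuotientAddGroup.mk' (k0Relations C dist) = 0 := by
    apply FreeAbelianGroup.lift_ext
    intro A
    exact h A
  refine ⟨fun a b => ?_⟩
  obtain ⟨x, rfl⟩ := QuotientAddGroup.mk'_surjective _ a
  obtain ⟨y, rfl⟩ := QuotientAddGroup.mk'_surjective _ b
  simp [hmk]

/-- If a functor preserves the triangles and every class of the target comes from
the source, then the Grothendieck group of the target vanishes if that of the source does. -/
lemma k0_subsingleton_of_functor {D : Type u₂} [Category.{v₂} D] [HasShift D ℤ]
    {dist' : Set (Triangle D)} (F : C ⥤ D) [F.CommShift ℤ]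
    (hF : ∀ S ∈ dist, F.mapTriangle.obj S ∈ dist')
    (hsurj : ∀ Y : D, ∃ X : C, k0Class dist' Y = k0Class dist' (F.obj X))
    (hC : Subsingleton (K0 C dist)) : Subsingleton (K0 D dist') := by
  refine k0_subsingleton fun Y => ?_
  obtain ⟨X, hX⟩ := hsurj Y
  have := k0Lift_k0Class (dist := dist) (fun X => k0Class dist' (F.obj X))
    (fun S hS => k0Class_eq_add (hF S hS)) X
  rw [hX, ← this, Subsingleton.elim (k0Class dist X) 0, map_zero]

end K0

/-! ### Objects of the idempotent completion modulo objects of the category -/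

section Pretriangulated

variable {T : Type u₁} [Category.{v₁} T] [Preadditive T] [HasZeroObject T]
  [HasShift T ℤ] [∀ n : ℤ, (shiftFunctor T n).Additive] [Pretriangulated T]

/-- A split monomorphism of a pretriangulated category is the inclusion of a direct
summand. -/
lemma exists_complement_of_splitMono {X Y : T} (f : X ⟶ Y) (r : Y ⟶ X) (hr : f ≫ r = 𝟙 X) :
    ∃ (Z : T) (g : Y ⟶ Z) (s : Z ⟶ Y), f ≫ g = 0 ∧ s ≫ g = 𝟙 Z ∧ r ≫ f + g ≫ s = 𝟙 Y := by
  obtain ⟨Z, g, h, hT⟩ := distinguished_cocone_triangle f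
  have hfg : f ≫ g = 0 := comp_distTriang_mor_zero₁₂ _ hT
  -- `h` is killed by `f⟦1⟧'`, which is again a split monomorphism.
  have hh : h = 0 := by
    have h₁ : h ≫ f⟦(1 : ℤ)⟧' = 0 := comp_distTriang_mor_zero₃₁ _ hT
    have h₂ : f⟦(1 : ℤ)⟧' ≫ r⟦(1 : ℤ)⟧' = 𝟙 _ := by
      rw [← Functor.map_comp, hr]; exact CategoryTheory.Functor.map_id _ _
    rw [← Category.comp_id h, ← h₂, ← Category.assoc, h₁, zero_comp]
  obtain ⟨s, hs⟩ := Triangle.yoneda_exact₂ _ hT (𝟙 Y - r ≫ f) (by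
    change f ≫ (𝟙 Y - r ≫ f) = 0
    simp [Preadditive.comp_sub, reassoc_of% hr])
  have : Epi g := Triangle.epi₂ _ hT hh
  change Z ⟶ Y at s
  change 𝟙 Y - r ≫ f = g ≫ s at hs
  refine ⟨Z, g, s, hfg, ?_, ?_⟩
  · rw [← cancel_epi g, ← Category.assoc, ← hs]
    simp [Preadditive.sub_comp, hfg]
  · rw [← hs]; abel

instance : HasFiniteBiproducts T := HasFiniteBiproducts.of_hasFiniteProducts

instance : HasBinaryBiproducts (Karoubi T) := hasBinaryBiproducts_of_finite_biproducts _

instance (X Y : T) : PreservesBinaryBiproduct X Y (toKaroubi T) :=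
  preservesBinaryBiproduct_of_preservesBiproduct _ _ _

/-- Two objects of the idempotent completion are stably isomorphic if they become
isomorphic after adding objects of the original category. -/
def StablyIso (A B : Karoubi T) : Prop :=
  ∃ X Y : T, Nonempty (A ⊞ (toKaroubi T).obj X ≅ B ⊞ (toKaroubi T).obj Y)

/-- A rearrangement of the summands of a sum of four objects. -/
def biprodInterchange {C : Type*} [Category* C] [Preadditive C] [HasBinaryBiproducts C]
    (A B X Y : C) : (A ⊞ B) ⊞ (X ⊞ Y) ≅ (A ⊞ X) ⊞ (B ⊞ Y) where
  hom := biprod.lift (biprod.map biprod.fst biprod.fst) (biprod.map biprod.snd biprod.snd)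
  inv := biprod.lift (biprod.map biprod.fst biprod.fst) (biprod.map biprod.snd biprod.snd)

lemma StablyIso.refl (A : Karoubi T) : StablyIso A A := ⟨0, 0, ⟨Iso.refl _⟩⟩

lemma StablyIso.symm {A B : Karoubi T} : StablyIso A B → StablyIso B A :=
  fun ⟨X, Y, ⟨e⟩⟩ => ⟨Y, X, ⟨e.symm⟩⟩

lemma StablyIso.of_iso {A B : Karoubi T} (e : A ≅ B) : StablyIso A B :=
  ⟨0, 0, ⟨biprod.mapIso e (Iso.refl _)⟩⟩

/-- Associativity suffices: `A ⊞ (X ⊞ 0) ≅ (A ⊞ X) ⊞ 0`. -/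
lemma stablyIso_add_right (A : Karoubi T) (X : T) : StablyIso A (A ⊞ (toKaroubi T).obj X) :=
  ⟨X ⊞ 0, 0, ⟨biprod.mapIso (Iso.refl _) ((toKaroubi T).mapBiprod X 0) ≪≫
    (biprod.associator _ _ _).symm⟩⟩

lemma StablyIso.trans {A B D : Karoubi T} : StablyIso A B → StablyIso B D → StablyIso A D := by
  rintro ⟨X, Y, ⟨e⟩⟩ ⟨X', Y', ⟨e'⟩⟩
  let J := toKaroubi T
  -- `A ⊞ X ⊞ X' ≅ B ⊞ Y ⊞ X' ≅ B ⊞ X' ⊞ Y ≅ D ⊞ Y' ⊞ Y`.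
  refine ⟨X ⊞ X', Y' ⊞ Y, ⟨?_⟩⟩
  exact biprod.mapIso (Iso.refl _) (J.mapBiprod X X') ≪≫ (biprod.associator _ _ _).symm ≪≫
    biprod.mapIso e (Iso.refl _) ≪≫ biprod.associator _ _ _ ≪≫
    biprod.mapIso (Iso.refl _) (biprod.braiding _ _) ≪≫ (biprod.associator _ _ _).symm ≪≫
    biprod.mapIso e' (Iso.refl _) ≪≫ biprod.associator _ _ _ ≪≫
    biprod.mapIso (Iso.refl _) (J.mapBiprod Y' Y).symm

lemma StablyIso.add {A B A' B' : Karoubi T} : StablyIso A B → StablyIso A' B' →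
    StablyIso (A ⊞ A') (B ⊞ B') := by
  rintro ⟨X, Y, ⟨e⟩⟩ ⟨X', Y', ⟨e'⟩⟩
  let J := toKaroubi T
  exact ⟨X ⊞ X', Y ⊞ Y', ⟨biprod.mapIso (Iso.refl _) (J.mapBiprod X X') ≪≫
    biprodInterchange _ _ _ _ ≪≫ biprod.mapIso e e' ≪≫ biprodInterchange _ _ _ _ ≪≫
    biprod.mapIso (Iso.refl _) (J.mapBiprod Y Y').symm⟩⟩

variable (T) in
/-- Stable isomorphism as an equivalence relation. -/
def stablyIsoSetoid : Setoid (Karoubi T) where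
  r := StablyIso
  iseqv := ⟨StablyIso.refl, StablyIso.symm, StablyIso.trans⟩

variable (T) in
/-- The classes of objects of the idempotent completion up to stable isomorphism. -/
def StableClasses : Type (max u₁ v₁) := Quotient (stablyIsoSetoid T)

/-- The stable class of an object of the idempotent completion. -/
def stableClass (A : Karoubi T) : StableClasses T := Quotient.mk (stablyIsoSetoid T) A

lemma stableClass_eq_iff {A B : Karoubi T} : stableClass A = stableClass B ↔ StablyIso A B :=
  Quotient.eq (r := stablyIsoSetoid T)

lemma stableClass_surjective : Function.Surjective (stableClass (T := T)) :=
  Quotient.mk_surjective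

instance : Add (StableClasses T) where
  add := Quotient.map₂ (fun A B => A ⊞ B) (fun _ _ h _ _ h' => StablyIso.add h h')

instance : Zero (StableClasses T) where
  zero := stableClass ((toKaroubi T).obj 0)

lemma stableClass_biprod (A B : Karoubi T) :
    stableClass (A ⊞ B) = stableClass A + stableClass B := rfl

lemma stableClass_of_iso {A B : Karoubi T} (e : A ≅ B) : stableClass A = stableClass B :=
  stableClass_eq_iff.2 (.of_iso e)

lemma stableClass_add_toKaroubi (A : Karoubi T) (X : T) :
    stableClass A + stableClass ((toKaroubi T).obj X) = stableClass A :=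
  (stableClass_eq_iff.2 (stablyIso_add_right A X)).symm

lemma stableClass_add_comm (a b : StableClasses T) : a + b = b + a := by
  obtain ⟨A, rfl⟩ := stableClass_surjective a
  obtain ⟨B, rfl⟩ := stableClass_surjective b
  exact stableClass_of_iso (biprod.braiding A B)

instance : AddCommMonoid (StableClasses T) where
  add_assoc a b c := by
    obtain ⟨A, rfl⟩ := stableClass_surjective a
    obtain ⟨B, rfl⟩ := stableClass_surjective b
    obtain ⟨D, rfl⟩ := stableClass_surjective c
    exact stableClass_of_iso (biprod.associator A B D)
  add_zero a := by
    obtain ⟨A, rfl⟩ := stableClass_surjective a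
    exact stableClass_add_toKaroubi A 0
  zero_add a := by
    rw [stableClass_add_comm]
    obtain ⟨A, rfl⟩ := stableClass_surjective a
    exact stableClass_add_toKaroubi A 0
  add_comm := stableClass_add_comm
  nsmul := nsmulRec

lemma stableClass_toKaroubi (X : T) : stableClass ((toKaroubi T).obj X) = 0 := by
  rw [← zero_add (stableClass ((toKaroubi T).obj X))]
  exact stableClass_add_toKaroubi _ X

lemma stableClass_add_complement (A : Karoubi T) :
    stableClass A + stableClass A.complement = 0 := by
  rw [← stableClass_biprod, stableClass_of_iso A.decomposition, stableClass_toKaroubi]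

/-- Mere existence is enough for negation: inverses in a commutative monoid are unique, so
complements need not be compared across representatives. -/
lemma exists_add_eq_zero (a : StableClasses T) : ∃ b, b + a = 0 := by
  obtain ⟨A, rfl⟩ := stableClass_surjective a
  exact ⟨_, (add_comm _ _).trans (stableClass_add_complement A)⟩

instance : Neg (StableClasses T) where
  neg a := (exists_add_eq_zero a).choose

instance : AddCommGroup (StableClasses T) where
  neg_add_cancel a := (exists_add_eq_zero a).choose_spec
  add_comm := add_comm
  zsmul := zsmulRec

/-- An object of the idempotent completion which is stably trivial belongs to the
category. -/
lemma mem_essImage_of_stableClass_eq_zero {A : Karoubi T} (hA : stableClass A = 0) :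
    (toKaroubi T).essImage A := by
  obtain ⟨X, Y', ⟨e'⟩⟩ := stableClass_eq_iff.1 (hA.trans (stableClass_toKaroubi (0 : T)).symm)
  let J := toKaroubi T
  let Y := (0 : T) ⊞ Y'
  let e : A ⊞ J.obj X ≅ J.obj Y := e' ≪≫ (J.mapBiprod 0 Y').symm
  -- By fullness, the inclusion and projection of the summand `X` of `Y` come from `T`. Its
  -- complement `Z` in `T` must then agree with its complement `A` in the completion.
  obtain ⟨f, hf⟩ := J.map_surjective (biprod.inr ≫ e.hom)
  obtain ⟨r, hr⟩ := J.map_surjective (e.inv ≫ biprod.snd)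
  obtain ⟨Z, g, s, hfg, hsg, hid⟩ := exists_complement_of_splitMono f r
    (J.map_injective (by simp [hf, hr]))
  have hsr : s ≫ r = 0 := by
    have : (r ≫ f + g ≫ s) ≫ r = r := by rw [hid, Category.id_comp]
    have hfr : f ≫ r = 𝟙 X := J.map_injective (by simp [hf, hr])
    have hgs : g ≫ s ≫ r = 0 := by simpa [hfr] using this
    rw [← Category.id_comp (s ≫ r), ← hsg, Category.assoc, hgs, comp_zero]
  have hgs : J.map g ≫ J.map s = 𝟙 _ - J.map r ≫ J.map f := by
    rw [← J.map_id, ← hid, J.map_add, J.map_comp, J.map_comp]; abel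
  have hsg' : J.map s ≫ J.map g = 𝟙 _ := by rw [← J.map_comp, hsg, J.map_id]
  refine ⟨Z, ⟨⟨J.map s ≫ e.inv ≫ biprod.fst, biprod.inl ≫ e.hom ≫ J.map g, ?_, ?_⟩⟩⟩
  · have h₁ : J.map s ≫ e.inv ≫ biprod.snd = 0 := by rw [← hr, ← J.map_comp, hsr, J.map_zero]
    have h₂ : e.inv ≫ biprod.fst ≫ biprod.inl ≫ e.hom = 𝟙 _ - e.inv ≫ biprod.snd ≫
        biprod.inr ≫ e.hom := by
      have : biprod.fst ≫ biprod.inl = 𝟙 (A ⊞ J.obj X) - biprod.snd ≫ biprod.inr := by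
        rw [← biprod.total]; abel
      rw [reassoc_of% this]
      simp [Preadditive.sub_comp, Preadditive.comp_sub]
    calc _ = J.map s ≫ (e.inv ≫ biprod.fst ≫ biprod.inl ≫ e.hom) ≫ J.map g := by simp
      _ = 𝟙 _ := by
        rw [h₂, Preadditive.sub_comp, Preadditive.comp_sub, Category.id_comp, hsg']
        simp only [Category.assoc]
        rw [reassoc_of% h₁]; simp
  · calc _ = biprod.inl ≫ e.hom ≫ (J.map g ≫ J.map s) ≫ e.inv ≫ biprod.fst := by simp
      _ = 𝟙 _ := by rw [hgs, hf, hr]; simp [Preadditive.sub_comp, Preadditive.comp_sub]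

end Pretriangulated

/-- Two composable morphisms are isomorphisms if both composites are unipotent. -/
lemma isIso_of_unipotent_comp {C : Type*} [Category* C] [Preadditive C] {M N : C} (α : M ⟶ N)
    (β : N ⟶ M) (h : (α ≫ β - 𝟙 M) ≫ (α ≫ β - 𝟙 M) = 0)
    (h' : (β ≫ α - 𝟙 N) ≫ (β ≫ α - 𝟙 N) = 0) : IsIso α := by
  -- With `ν = α ≫ β - 𝟙`, this is `(1 + ν)(1 - ν) = 1 - ν² = 1`.
  have h₁ : α ≫ β ≫ (𝟙 M - (α ≫ β - 𝟙 M)) = 𝟙 M := by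
    have : α ≫ β ≫ (𝟙 M - (α ≫ β - 𝟙 M)) = 𝟙 M - (α ≫ β - 𝟙 M) ≫ (α ≫ β - 𝟙 M) := by
      simp only [Preadditive.comp_sub, Preadditive.sub_comp, Category.assoc, Category.comp_id,
        Category.id_comp]
      abel
    rw [this, h, sub_zero]
  have h₂ : ((𝟙 N - (β ≫ α - 𝟙 N)) ≫ β) ≫ α = 𝟙 N := by
    have : ((𝟙 N - (β ≫ α - 𝟙 N)) ≫ β) ≫ α = 𝟙 N - (β ≫ α - 𝟙 N) ≫ (β ≫ α - 𝟙 N) := by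
      simp only [Preadditive.comp_sub, Preadditive.sub_comp, Category.assoc, Category.comp_id,
        Category.id_comp]
      abel
    rw [this, h', sub_zero]
  have : IsSplitMono α := ⟨⟨⟨_, h₁⟩⟩⟩
  have : IsSplitEpi α := ⟨⟨⟨_, h₂⟩⟩⟩
  exact isIso_of_mono_of_isSplitEpi α

/-! ### Additivity of stable classes on summands of distinguished triangles. -/

section Pretriangulated

variable {T : Type u₁} [Category.{v₁} T] [Preadditive T] [HasZeroObject T]
  [HasShift T ℤ] [∀ n : ℤ, (shiftFunctor T n).Additive] [Pretriangulated T]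

lemma exists_extension_of_distTriang (R : Triangle T) (hR : R ∈ distTriang T) {N : T}
    (f : R.obj₁ ⟶ N) (hf : R.mor₃ ≫ f⟦(1 : ℤ)⟧' = 0) :
    ∃ m : R.obj₂ ⟶ N, R.mor₁ ≫ m = f := by
  obtain ⟨n, hn⟩ := Triangle.yoneda_exact₂ _
    (rot_of_distTriang _ (rot_of_distTriang _ hR)) (f⟦(1 : ℤ)⟧') hf
  obtain ⟨m, rfl⟩ := (shiftFunctor T (1 : ℤ)).map_surjective n
  change R.obj₂ ⟶ N at m
  -- The sign compensates for the one that rotation puts on `R.mor₁⟦1⟧'`.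
  refine ⟨-m, (shiftFunctor T (1 : ℤ)).map_injective ?_⟩
  rw [hn]
  change _ = (-R.mor₁⟦(1 : ℤ)⟧') ≫ m⟦(1 : ℤ)⟧'
  simp only [Preadditive.comp_neg, Preadditive.neg_comp, Functor.map_neg, Functor.map_comp]

/-- Exactness of distinguished triangles with respect to objects of the idempotent
completion. -/
lemma exists_lift_of_distTriang (R : Triangle T) (hR : R ∈ distTriang T) {N : Karoubi T}
    (t : N ⟶ (toKaroubi T).obj R.obj₂) (ht : t ≫ (toKaroubi T).map R.mor₂ = 0) :
    ∃ w : N ⟶ (toKaroubi T).obj R.obj₁, t = w ≫ (toKaroubi T).map R.mor₁ := by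
  -- `N` is a retract of `N.X`, so the lift is found in `T` and then restricted to `N`.
  obtain ⟨t', ht'⟩ := (toKaroubi T).map_surjective (N.decompId_p ≫ t)
  obtain ⟨w, hw⟩ := Triangle.coyoneda_exact₂ R hR t' ((toKaroubi T).map_injective (by
    rw [Functor.map_comp, ht', Category.assoc, ht, comp_zero, Functor.map_zero]))
  refine ⟨N.decompId_i ≫ (toKaroubi T).map w, ?_⟩
  rw [Category.assoc, ← Functor.map_comp, ← hw, ht', ← Karoubi.decompId_assoc]

/-- Every object of the idempotent completion is a direct summand of an object of the category. -/
lemma exists_complement (A : Karoubi T) : ∃ (X : T) (A' : Karoubi T)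
    (a : A ⟶ (toKaroubi T).obj X) (a' : (toKaroubi T).obj X ⟶ A)
    (b : A' ⟶ (toKaroubi T).obj X) (b' : (toKaroubi T).obj X ⟶ A'),
    a ≫ a' = 𝟙 A ∧ b ≫ b' = 𝟙 A' ∧ a ≫ b' = 0 ∧ b ≫ a' = 0 ∧ a' ≫ a + b' ≫ b = 𝟙 _ ∧
      stableClass A + stableClass A' = 0 := by
  let e := A.decomposition
  refine ⟨A.X, A.complement, biprod.inl ≫ e.hom, e.inv ≫ biprod.fst, biprod.inr ≫ e.hom,
    e.inv ≫ biprod.snd, by simp, by simp, by simp, by simp, ?_, stableClass_add_complement A⟩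
  have : e.inv ≫ (biprod.fst ≫ biprod.inl + biprod.snd ≫ biprod.inr) ≫ e.hom = 𝟙 _ := by
    rw [biprod.total]; simp
  simpa only [Preadditive.add_comp, Preadditive.comp_add, Category.assoc] using this

/-- The middle object of a direct summand of a distinguished triangle, after adding complements
of the outer objects. -/
lemma exists_middle_iso {R : Triangle T} (hR : R ∈ distTriang T) {A B C : Karoubi T}
    {f : A ⟶ B} {g : B ⟶ C} {h : C ⟶ A⟦(1 : ℤ)⟧}
    (ρ : Retract (Triangle.mk f g h) ((toKaroubi T).mapTriangle.obj R)) {X Z : T}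
    {A' C' : Karoubi T}
    {a : A ⟶ (toKaroubi T).obj X} {a' : (toKaroubi T).obj X ⟶ A}
    {b : A' ⟶ (toKaroubi T).obj X} {b' : (toKaroubi T).obj X ⟶ A'}
    (haa : a ≫ a' = 𝟙 A) (hab : a ≫ b' = 0) (hba : b ≫ a' = 0) (hbb : b ≫ b' = 𝟙 A')
    (hX : a' ≫ a + b' ≫ b = 𝟙 _)
    {c : C ⟶ (toKaroubi T).obj Z} {c' : (toKaroubi T).obj Z ⟶ C}
    {d : C' ⟶ (toKaroubi T).obj Z} {d' : (toKaroubi T).obj Z ⟶ C'}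
    (hcc : c ≫ c' = 𝟙 C) (hcd : c ≫ d' = 0) (hdc : d ≫ c' = 0) (hdd : d ≫ d' = 𝟙 C')
    (hZ : c' ≫ c + d' ≫ d = 𝟙 _) :
    ∃ W : T, Nonempty (B ⊞ (A' ⊞ C') ≅ (toKaroubi T).obj W) := by
  let J := toKaroubi T
  obtain ⟨i₁, r₁, i₂, r₂, i₃, r₃, ir₁, ir₂, ir₃, i₁₂, i₂₃, i₃₁, r₁₂, r₂₃, r₃₁⟩ :
    ∃ (i₁ : A ⟶ J.obj R.obj₁) (r₁ : J.obj R.obj₁ ⟶ A) (i₂ : B ⟶ J.obj R.obj₂)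
      (r₂ : J.obj R.obj₂ ⟶ B) (i₃ : C ⟶ J.obj R.obj₃) (r₃ : J.obj R.obj₃ ⟶ C),
      i₁ ≫ r₁ = 𝟙 A ∧ i₂ ≫ r₂ = 𝟙 B ∧ i₃ ≫ r₃ = 𝟙 C ∧
      f ≫ i₂ = i₁ ≫ J.map R.mor₁ ∧ g ≫ i₃ = i₂ ≫ J.map R.mor₂ ∧
      h ≫ i₁⟦(1 : ℤ)⟧' = i₃ ≫ J.map R.mor₃ ≫ (J.commShiftIso (1 : ℤ)).hom.app R.obj₁ ∧
      J.map R.mor₁ ≫ r₂ = r₁ ≫ f ∧ J.map R.mor₂ ≫ r₃ = r₂ ≫ g ∧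
      (J.map R.mor₃ ≫ (J.commShiftIso (1 : ℤ)).hom.app R.obj₁) ≫ r₁⟦(1 : ℤ)⟧' = r₃ ≫ h :=
    ⟨ρ.i.hom₁, ρ.r.hom₁, ρ.i.hom₂, ρ.r.hom₂, ρ.i.hom₃, ρ.r.hom₃,
      congr_arg TriangleMorphism.hom₁ ρ.retract, congr_arg TriangleMorphism.hom₂ ρ.retract,
      congr_arg TriangleMorphism.hom₃ ρ.retract, ρ.i.comm₁, ρ.i.comm₂, ρ.i.comm₃,
      ρ.r.comm₁, ρ.r.comm₂, ρ.r.comm₃⟩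
  let s := J.commShiftIso (1 : ℤ)
  have snat {X Y : T} (k : X ⟶ Y) : J.map (k⟦(1 : ℤ)⟧') = s.hom.app X ≫ (J.map k)⟦(1 : ℤ)⟧' ≫
      s.inv.app Y := by
    have := s.hom.naturality_assoc k (s.inv.app Y)
    simpa using this
  -- `k` is `h` on `C`, extended by zero to `Z = C ⊞ C' → (A ⊞ A')⟦1⟧ = X⟦1⟧`. The `uᵢ` and `vᵢ`
  -- extend the retraction data by zero; `q` and `p` project onto `A'` and `C'`.
  obtain ⟨k, hk⟩ := J.map_surjective (c' ≫ h ≫ a⟦(1 : ℤ)⟧' ≫ s.inv.app X)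
  obtain ⟨u₁, hu₁⟩ := J.map_surjective (a' ≫ i₁)
  obtain ⟨u₃, hu₃⟩ := J.map_surjective (c' ≫ i₃)
  obtain ⟨v₁, hv₁⟩ := J.map_surjective (r₁ ≫ a)
  obtain ⟨v₃, hv₃⟩ := J.map_surjective (r₃ ≫ c)
  obtain ⟨q, hq⟩ := J.map_surjective (b' ≫ b)
  obtain ⟨p, hp⟩ := J.map_surjective (d' ≫ d)
  obtain ⟨W, x, z, hW⟩ := distinguished_cocone_triangle₂ k
  have hxz : x ≫ z = 0 := comp_distTriang_mor_zero₁₂ _ hW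
  have hJxz : J.map x ≫ J.map z = 0 := by rw [← J.map_comp, hxz, J.map_zero]
  have ha : a⟦(1 : ℤ)⟧' ≫ a'⟦(1 : ℤ)⟧' = 𝟙 _ := by
    rw [← Functor.map_comp, haa]; exact CategoryTheory.Functor.map_id _ _
  have hu : k ≫ u₁⟦(1 : ℤ)⟧' = u₃ ≫ R.mor₃ := J.map_injective (by
    simp only [Functor.map_comp, snat, hu₁, hu₃, hk, Category.assoc, Iso.inv_hom_id_app_assoc]
    rw [reassoc_of% ha, reassoc_of% i₃₁]
    simp only [s, Iso.hom_inv_id_app]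
    exact congr_arg (fun t => c' ≫ i₃ ≫ t) (Category.comp_id _))
  have hv : R.mor₃ ≫ v₁⟦(1 : ℤ)⟧' = v₃ ≫ k := J.map_injective (by
    simp only [Functor.map_comp, snat, hv₁, hv₃, hk, Category.assoc]
    rw [reassoc_of% hcc, ← reassoc_of% r₃₁])
  have hpk : p ≫ k = 0 := J.map_injective (by
    rw [J.map_comp, hp, hk, J.map_zero, Category.assoc, reassoc_of% hdc, zero_comp, comp_zero])
  have hkq : k ≫ q⟦(1 : ℤ)⟧' = 0 := by
    have hka : k = k ≫ (𝟙 X - q)⟦(1 : ℤ)⟧' := by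
      have : J.map (𝟙 X - q) = a' ≫ a := by
        rw [J.map_sub, J.map_id, hq, ← hX]; abel
      apply J.map_injective
      rw [J.map_comp, snat, this, hk, Functor.map_comp]
      simp only [Category.assoc, Iso.inv_hom_id_app_assoc]
      rw [reassoc_of% ha]
    rw [hka, Category.assoc, ← Functor.map_comp, Preadditive.sub_comp, Category.id_comp]
    have : q ≫ q = q := J.map_injective (by
      rw [J.map_comp, hq, Category.assoc, reassoc_of% hbb])
    rw [this, sub_self, Functor.map_zero, comp_zero]
  obtain ⟨u₂, hu₁₂, hu₂₃⟩ : ∃ u₂ : W ⟶ R.obj₂, x ≫ u₂ = u₁ ≫ R.mor₁ ∧ z ≫ u₃ = u₂ ≫ R.mor₂ :=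
    complete_distinguished_triangle_morphism₂ _ R hW hR u₁ u₃ hu
  obtain ⟨v₂, hv₁₂, hv₂₃⟩ : ∃ v₂ : R.obj₂ ⟶ W, R.mor₁ ≫ v₂ = v₁ ≫ x ∧ R.mor₂ ≫ v₃ = v₂ ≫ z :=
    complete_distinguished_triangle_morphism₂ R _ hR hW v₁ v₃ hv
  -- As `k` vanishes on `C'` and does not meet `A'`, the summand `C'` lifts to `W` and the
  -- projection onto `A'` extends to `W`.
  obtain ⟨l, hl⟩ : ∃ l : Z ⟶ W, p = l ≫ z := Triangle.coyoneda_exact₃ _ hW p hpk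
  obtain ⟨m, hm⟩ : ∃ m : W ⟶ X, x ≫ m = q := exists_extension_of_distTriang _ hW q hkq
  have exR {N : Karoubi T} (t : N ⟶ B) (ht : t ≫ g = 0) : ∃ w : N ⟶ A, t = w ≫ f := by
    obtain ⟨w, hw⟩ := exists_lift_of_distTriang R hR (t ≫ i₂) (by
      change (t ≫ i₂) ≫ J.map R.mor₂ = 0
      rw [Category.assoc, ← i₂₃, reassoc_of% ht, zero_comp])
    change t ≫ i₂ = w ≫ J.map R.mor₁ at hw
    exact ⟨w ≫ r₁, by rw [Category.assoc, ← r₁₂, ← reassoc_of% hw, ir₂, Category.comp_id]⟩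
  have exW {N : Karoubi T} (t : N ⟶ J.obj W) (ht : t ≫ J.map z = 0) :
      ∃ w : N ⟶ J.obj X, t = w ≫ J.map x := exists_lift_of_distTriang _ hW t ht
  let α : B ⊞ (A' ⊞ C') ⟶ J.obj W :=
    biprod.desc (i₂ ≫ J.map v₂) (biprod.desc (b ≫ J.map x) (d ≫ J.map l))
  let β : J.obj W ⟶ B ⊞ (A' ⊞ C') :=
    biprod.lift (J.map u₂ ≫ r₂) (biprod.lift (J.map m ≫ b') (J.map z ≫ d'))
  -- `f'` and `g'` are the maps of the sum of `A → B → C` with `A' = A'` and `C' = C'`. The next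
  -- identities say that `α` and `β` compare it with `X → W → Z`, with identities on the outer
  -- terms.
  let f' : J.obj X ⟶ B ⊞ (A' ⊞ C') := biprod.lift (a' ≫ f) (biprod.lift b' 0)
  let g' : B ⊞ (A' ⊞ C') ⟶ J.obj Z := biprod.desc (g ≫ c) (biprod.desc 0 d)
  have Jmap {X₁ X₂ Y Y' : T} {s₁ : X₁ ⟶ Y} {s₂ : Y ⟶ X₂} {t₁ : X₁ ⟶ Y'} {t₂ : Y' ⟶ X₂}
      (h : s₁ ≫ s₂ = t₁ ≫ t₂) : J.map s₁ ≫ J.map s₂ = J.map t₁ ≫ J.map t₂ := by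
    rw [← J.map_comp, h, J.map_comp]
  have hJl : J.map l ≫ J.map z = d' ≫ d := by rw [← J.map_comp, ← hl, hp]
  have hJm : J.map x ≫ J.map m = b' ≫ b := by rw [← J.map_comp, hm, hq]
  have fα : f' ≫ α = J.map x := by
    simp only [f', α, biprod.lift_desc, zero_comp, add_zero, Category.assoc]
    rw [reassoc_of% i₁₂, Jmap hv₁₂, hv₁, Category.assoc, reassoc_of% ir₁, ← Category.assoc,
      ← Category.assoc, ← Preadditive.add_comp, hX]
    exact Category.id_comp _
  have αg : α ≫ J.map z = g' := by
    apply biprod.hom_ext'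
    · simp only [α, g', biprod.inl_desc, biprod.inl_desc_assoc, Category.assoc]
      rw [← Jmap hv₂₃, hv₃, ← reassoc_of% i₂₃, reassoc_of% ir₃]
    · apply biprod.hom_ext'
      · simp only [α, g', biprod.inl_desc, biprod.inr_desc_assoc, biprod.inl_desc_assoc,
          biprod.inr_desc, Category.assoc, hJxz]
        exact comp_zero
      · simp only [α, g', biprod.inr_desc, biprod.inr_desc_assoc, Category.assoc]
        rw [hJl, reassoc_of% hdd]
  have xβ : J.map x ≫ β = f' := by
    apply biprod.hom_ext
    · simp only [β, f', biprod.lift_fst, Category.assoc]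
      rw [reassoc_of% (Jmap hu₁₂), hu₁, r₁₂, Category.assoc, reassoc_of% ir₁]
    · apply biprod.hom_ext
      · simp only [β, f', biprod.lift_fst, biprod.lift_snd, Category.assoc]
        rw [reassoc_of% hJm, hbb, Category.comp_id]
      · simp only [β, f', biprod.lift_snd, Category.assoc]
        rw [reassoc_of% hJxz, zero_comp]
  have βg : β ≫ g' = J.map z := by
    simp only [β, g', biprod.lift_desc, comp_zero, zero_add, Category.assoc]
    rw [← reassoc_of% r₂₃, ← reassoc_of% (Jmap hu₂₃), hu₃, Category.assoc, reassoc_of% ir₃,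
      ← Preadditive.comp_add, hZ]
    exact Category.comp_id _
  refine ⟨W, ⟨@asIso _ _ _ _ α (isIso_of_unipotent_comp α β ?_ ?_)⟩⟩
  · have h₁ : f' ≫ (α ≫ β - 𝟙 _) = 0 := by
      rw [Preadditive.comp_sub, ← Category.assoc, fα, xβ, Category.comp_id, sub_self]
    have h₂ : (α ≫ β - 𝟙 _) ≫ g' = 0 := by
      rw [Preadditive.sub_comp, Category.assoc, βg, αg, Category.id_comp, sub_self]
    -- By exactness, the error, being killed by `g'`, factors through `f'`; since `f'` followed by
    -- the error is zero, it squares to zero.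
    obtain ⟨w, hw⟩ : ∃ w : B ⊞ (A' ⊞ C') ⟶ J.obj X, α ≫ β - 𝟙 _ = w ≫ f' := by
      generalize α ≫ β - 𝟙 _ = t at h₂
      have hg' : t ≫ g' = (t ≫ biprod.fst) ≫ g ≫ c + (t ≫ biprod.snd ≫ biprod.snd) ≫ d := by
        simp only [g', biprod.desc_eq, Preadditive.comp_add, Category.assoc, comp_zero, zero_add]
      rw [hg'] at h₂
      have hB : (t ≫ biprod.fst) ≫ g = 0 := by
        have := congr_arg (fun t => t ≫ c') h₂
        simpa only [Preadditive.add_comp, Category.assoc, hcc, hdc, comp_zero, add_zero,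
          Category.comp_id, zero_comp] using this
      have hC : t ≫ biprod.snd ≫ biprod.snd = 0 := by
        have := congr_arg (fun t => t ≫ d') h₂
        simpa only [Preadditive.add_comp, Category.assoc, hdd, hcd, comp_zero, zero_add,
          Category.comp_id, zero_comp] using this
      obtain ⟨w, hw⟩ := exR _ hB
      refine ⟨w ≫ a + (t ≫ biprod.snd ≫ biprod.fst) ≫ b, ?_⟩
      apply biprod.hom_ext
      · simp only [f', Preadditive.add_comp, Category.assoc, biprod.lift_fst, reassoc_of% haa,
          reassoc_of% hba, zero_comp, comp_zero, add_zero, hw]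
      · apply biprod.hom_ext
        · simp only [f', Preadditive.add_comp, Category.assoc, biprod.lift_fst, biprod.lift_snd,
            hab, hbb, comp_zero, zero_add, Category.comp_id]
        · simp only [f', Category.assoc, biprod.lift_snd, comp_zero, hC]
    conv_lhs => enter [1]; rw [hw]
    rw [Category.assoc, h₁, comp_zero]
  · have h₁ : J.map x ≫ (β ≫ α - 𝟙 _) = 0 := by
      rw [Preadditive.comp_sub, ← Category.assoc, xβ, fα, Category.comp_id, sub_self]
    have h₂ : (β ≫ α - 𝟙 _) ≫ J.map z = 0 := by
      rw [Preadditive.sub_comp, Category.assoc, αg, βg, Category.id_comp, sub_self]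
    obtain ⟨w, hw⟩ := exW _ h₂
    conv_lhs => enter [1]; rw [hw]
    rw [Category.assoc, h₁, comp_zero]

/-- Stable classes are additive on direct summands of distinguished triangles. -/
lemma stableClass_additive {S : Triangle (Karoubi T)} (hS : S ∈ karoubiDistTriang T) :
    stableClass S.obj₂ = stableClass S.obj₁ + stableClass S.obj₃ := by
  obtain ⟨R, hR, ⟨ρ⟩⟩ := hS
  obtain ⟨X, A', a, a', b, b', haa, hbb, hab, hba, hX, hA⟩ := exists_complement S.obj₁
  obtain ⟨Z, C', c, c', d, d', hcc, hdd, hcd, hdc, hZ, hC⟩ := exists_complement S.obj₃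
  obtain ⟨W, ⟨e⟩⟩ := exists_middle_iso hR (f := S.mor₁) (g := S.mor₂) (h := S.mor₃) ρ
    haa hab hba hbb hX hcc hcd hdc hdd hZ
  have h := stableClass_of_iso e
  rw [stableClass_toKaroubi, stableClass_biprod, stableClass_biprod] at h
  rw [eq_neg_of_add_eq_zero_left h, eq_neg_of_add_eq_zero_left hA, eq_neg_of_add_eq_zero_left hC]
  abel

variable (T) in
/-- A triangulated category is idempotent complete if the Grothendieck group of its idempotent
completion vanishes. -/
theorem isIdempotentComplete_of_k0 (h : Subsingleton (K0Completion T)) :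
    IsIdempotentComplete T := by
  have : (toKaroubi T).EssSurj := ⟨fun A => mem_essImage_of_stableClass_eq_zero (by
    rw [← k0Lift_k0Class (dist := karoubiDistTriang T) stableClass
      (fun _ => stableClass_additive) A, Subsingleton.elim (k0Class _ A) 0, map_zero])⟩
  have : (toKaroubi T).IsEquivalence := { }
  exact (isIdempotentComplete_iff_of_equivalence (toKaroubi T).asEquivalence).2 inferInstance

end Pretriangulated

/-! ### Grothendieck groups of Verdier quotients and of completions. -/

section K0

variable {T : Type u₁} [Category.{v₁} T] [Preadditive T] [HasZeroObject T]
  [HasShift T ℤ] [∀ n : ℤ, (shiftFunctor T n).Additive] [Pretriangulated T]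

lemma k0Class_zero : k0Class (distTriang T) (0 : T) = 0 := by
  have h := k0Class_eq_add (contractible_distinguished (0 : T))
  exact left_eq_add.1 h

/-- The generators are objects, not isomorphism classes, so invariance has to come from the triangle
`X → Y → 0`. -/
lemma k0Class_of_iso {X Y : T} (e : X ≅ Y) :
    k0Class (distTriang T) X = k0Class (distTriang T) Y := by
  have h := k0Class_eq_add (isomorphic_distinguished _ (contractible_distinguished X)
    (Triangle.mk e.hom (0 : Y ⟶ 0) 0)
    (Triangle.isoMk _ _ (Iso.refl _) e.symm (Iso.refl _)
      (e.hom_inv_id.trans (Category.comp_id _).symm) ((isZero_zero T).eq_of_tgt _ _)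
      ((isZero_zero T).eq_of_src _ _)))
  change k0Class _ Y = k0Class _ X + k0Class _ (0 : T) at h
  rw [h, k0Class_zero, add_zero]

lemma k0Class_biprod (X Y : T) :
    k0Class (distTriang T) (X ⊞ Y) = k0Class (distTriang T) X + k0Class (distTriang T) Y :=
  k0Class_eq_add (binaryBiproductTriangle_distinguished X Y)

lemma k0Class_shift_one (X : T) :
    k0Class (distTriang T) (X⟦(1 : ℤ)⟧) = -k0Class (distTriang T) X := by
  have h := k0Class_eq_add (contractible_distinguished₂ X)
  change k0Class _ (0 : T) = k0Class _ X + k0Class _ (X⟦(1 : ℤ)⟧) at h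
  rw [k0Class_zero] at h
  exact (neg_eq_of_add_eq_zero_right h.symm).symm

/-- Even shifts preserve classes, which is why the swindle shifts by two. -/
lemma k0Class_shift_two (X : T) :
    k0Class (distTriang T) (X⟦(2 : ℤ)⟧) = k0Class (distTriang T) X := by
  rw [k0Class_of_iso ((shiftFunctorAdd' T (1 : ℤ) 1 2 (by norm_num)).app X)]
  exact (k0Class_shift_one _).trans (by rw [k0Class_shift_one, neg_neg])

lemma k0Class_shift_neg_two (X : T) :
    k0Class (distTriang T) (X⟦(-2 : ℤ)⟧) = k0Class (distTriang T) X := by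
  rw [← k0Class_shift_two]
  exact k0Class_of_iso ((shiftFunctorCompIsoId T (-2 : ℤ) 2 (by norm_num)).app X)

/-- The Grothendieck group of a Verdier quotient vanishes if that of the original category does. -/
lemma k0_verdier_subsingleton [IsTriangulated T] (P : ObjectProperty T)
    (h : Subsingleton (K0 T (distTriang T))) :
    Subsingleton (K0 (Verdier P) (distTriang (Verdier P))) :=
  k0_subsingleton_of_functor (verdierQ P) (fun S hS => (verdierQ P).map_distinguished S hS)
    (fun Y => ⟨(verdierQ P).objPreimage Y, k0Class_of_iso ((verdierQ P).objObjPreimageIso Y).symm⟩) h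

/-- The Grothendieck group of the idempotent completion of an idempotent complete triangulated
category vanishes if that of the original category does. -/
lemma k0Completion_subsingleton [IsIdempotentComplete T]
    (h : Subsingleton (K0 T (distTriang T))) : Subsingleton (K0Completion T) := by
  have hJ (S : Triangle T) (hS : S ∈ distTriang T) :
      (toKaroubi T).mapTriangle.obj S ∈ karoubiDistTriang T := ⟨S, hS, ⟨Retract.refl _⟩⟩
  refine k0_subsingleton_of_functor (toKaroubi T) hJ (fun Y => ?_) h
  let X := (toKaroubi T).objPreimage Y
  let e : (toKaroubi T).obj X ≅ Y := (toKaroubi T).objObjPreimageIso Y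
  refine ⟨X, ?_⟩
  have h0 : k0Class (karoubiDistTriang T) ((toKaroubi T).obj 0) = 0 :=
    left_eq_add.1 (k0Class_eq_add (hJ _ (contractible_distinguished (0 : T))))
  -- `X → Y → 0` is isomorphic to the image of a contractible triangle, hence a summand of it, and
  -- yields `[Y] = [X]` in the completion.
  let S : Triangle (Karoubi T) := Triangle.mk (Z := (toKaroubi T).obj 0) e.hom 0 0
  have e' : S ≅ (toKaroubi T).mapTriangle.obj (contractibleTriangle X) :=
    Triangle.isoMk _ _ (Iso.refl _) e.symm (Iso.refl _)
      (by
        change e.hom ≫ e.inv = 𝟙 _ ≫ (toKaroubi T).map (𝟙 X)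
        rw [e.hom_inv_id, CategoryTheory.Functor.map_id, Category.comp_id])
      (((toKaroubi T).map_isZero (isZero_zero T)).eq_of_tgt _ _)
      (((toKaroubi T).map_isZero (isZero_zero T)).eq_of_src _ _)
  have hS : S ∈ karoubiDistTriang T := ⟨_, contractible_distinguished X, ⟨e'.retract⟩⟩
  have h1 := k0Class_eq_add hS
  change k0Class _ Y = k0Class _ ((toKaroubi T).obj X) + k0Class _ ((toKaroubi T).obj 0) at h1
  rw [h1, h0, add_zero]

end K0

/-! ### Infinite sums of shifts of a complex -/

section Swindle

/-- The iterates of a functor applied to an object. -/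
def iterObj {C : Type*} [Category* C] (G : C ⥤ C) (A : C) : ℕ → C
  | 0 => A
  | k + 1 => G.obj (iterObj G A k)

/-- The sum `B` of the iterates of `G` at `A` satisfies `B ≅ A ⊞ G B`. -/
lemma exists_iso_biprod_of_hasCoproduct_iterObj {C : Type*} [Category* C] [Preadditive C]
    [HasBinaryBiproducts C] (G : C ⥤ C) [PreservesColimitsOfSize.{0, 0} G] (A : C)
    [HasCoproduct (iterObj G A)] : ∃ B : C, Nonempty (B ≅ A ⊞ G.obj B) := by
  let F := iterObj G A
  -- `G` preserves the coproduct, so `G.obj (∐ F)` is the sum of the terms `F (k + 1)`: everything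
  -- but `A`.
  let hc := isColimitCofanMkObjOfIsColimit G F (Sigma.ι F) (coproductIsCoproduct F)
  let φ : G.obj (∐ F) ⟶ ∐ F := Cofan.IsColimit.desc hc (fun k => Sigma.ι F (k + 1))
  have hφ (k : ℕ) : G.map (Sigma.ι F k) ≫ φ = Sigma.ι F (k + 1) := Cofan.IsColimit.fac hc _ k
  let ι₀ : A ⟶ ∐ F := Sigma.ι F 0
  let p : ∀ k, F k ⟶ A ⊞ G.obj (∐ F)
    | 0 => biprod.inl
    | k + 1 => G.map (Sigma.ι F k) ≫ biprod.inr
  refine ⟨∐ F, ⟨⟨Sigma.desc p, biprod.desc ι₀ φ, ?_, ?_⟩⟩⟩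
  · apply Sigma.hom_ext
    rintro (_ | k)
    · rw [Sigma.ι_desc_assoc, Category.comp_id]
      exact biprod.inl_desc _ _
    · rw [Sigma.ι_desc_assoc, Category.comp_id]
      change (G.map (Sigma.ι F k) ≫ biprod.inr) ≫ _ = _
      rw [Category.assoc, biprod.inr_desc, hφ]
  · apply biprod.hom_ext'
    · rw [biprod.inl_desc_assoc, Category.comp_id]
      exact Sigma.ι_desc p 0
    · rw [biprod.inr_desc_assoc, Category.comp_id]
      refine Cofan.IsColimit.hom_ext hc _ _ (fun k => ?_)
      change G.map (Sigma.ι F k) ≫ φ ≫ _ = G.map (Sigma.ι F k) ≫ _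
      rw [reassoc_of% hφ]
      exact Sigma.ι_desc p (k + 1)

variable {E : Type u₂} [Category.{v₂} E] [Preadditive E]

lemma isZero_iterObj_shift {A : CochainComplex E ℤ} {e : ℤ} (k : ℕ) (n : ℤ)
    (h : IsZero (A.X (n + k * e))) :
    IsZero ((iterObj (shiftFunctor (CochainComplex E ℤ) e) A k).X n) := by
  induction k generalizing n with
  | zero => simpa [iterObj] using h
  | succ k ih =>
    refine ih (n + e) ?_
    have : n + e + k * e = n + ((k + 1 : ℕ) : ℤ) * e := by push_cast; ring
    rwa [this]

variable [HasZeroObject E] [HasBinaryBiproducts E]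

/-- The biproduct of the first `N` terms serves as the coproduct, so `E` needs no infinite sums. -/
lemma hasCoproduct_of_isZero (f : ℕ → E) (N : ℕ) (hf : ∀ k, N ≤ k → IsZero (f k)) :
    HasCoproduct f := by
  have : HasFiniteProducts E := hasFiniteProducts_of_has_binary_and_terminal
  have : HasFiniteBiproducts E := HasFiniteBiproducts.of_hasFiniteProducts
  let c : Cofan f := Cofan.mk (⨁ fun i : Fin N => f i)
    (fun k => if h : k < N then biproduct.ι (fun i : Fin N => f i) ⟨k, h⟩ else 0)
  refine ⟨⟨⟨c, Cofan.IsColimit.mk c (fun s => biproduct.desc fun i : Fin N => s.inj i)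
    (fun s k => ?_) (fun s m hm => ?_)⟩⟩⟩
  · by_cases h : k < N
    · simp [c, h]
    · exact (hf k (not_lt.1 h)).eq_of_src _ _
  · refine biproduct.hom_ext' _ _ (fun i => ?_)
    rw [biproduct.ι_desc, ← hm i]
    simp [c]

/-- A complex whose shifts by multiples of `e` leave each degree eventually is the
difference of a complex `B` and its shift by `e`. -/
lemma exists_iso_biprod_shift (A : CochainComplex E ℤ) (e : ℤ)
    (hA : ∀ n : ℤ, ∃ N : ℕ, ∀ k : ℕ, N ≤ k → IsZero (A.X (n + k * e))) :
    ∃ B : CochainComplex E ℤ, Nonempty (B ≅ A ⊞ B⟦e⟧) := by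
  let F := iterObj (shiftFunctor (CochainComplex E ℤ) e) A
  -- Colimits of complexes are formed degreewise, and each degree meets finitely many nonzero terms.
  have (n : ℤ) : HasColimit (Discrete.functor F ⋙ HomologicalComplex.eval E (.up ℤ) n) := by
    obtain ⟨N, hN⟩ := hA n
    have : HasCoproduct (fun k => (F k).X n) :=
      hasCoproduct_of_isZero _ N (fun k hk => isZero_iterObj_shift k n (hN k hk))
    exact hasColimit_of_iso (F := Discrete.functor fun k => (F k).X n)
      (Discrete.natIso fun _ => Iso.refl _)
  have : HasCoproduct F := inferInstanceAs (HasColimit (Discrete.functor F))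
  have : HasBinaryBiproducts (CochainComplex E ℤ) := ⟨fun _ _ => inferInstance⟩
  exact exists_iso_biprod_of_hasCoproduct_iterObj (shiftFunctor (CochainComplex E ℤ) e) A

end Swindle

/-! ### Truncations of complexes -/

section Truncation

variable {E : Type u₂} [Category.{v₂} E] [Preadditive E] [HasZeroObject E]

/-- The brutal truncation of a complex in nonnegative degrees. -/
def truncNonneg (A : CochainComplex E ℤ) : CochainComplex E ℤ where
  X
    | .ofNat n => A.X (.ofNat n)
    | .negSucc _ => 0
  d
    | .ofNat n, .ofNat m => A.d (.ofNat n) (.ofNat m)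
    | .ofNat _, .negSucc _ => 0
    | .negSucc _, _ => 0
  shape := by
    rintro (n | n) (m | m) h
    · exact A.shape _ _ h
    all_goals rfl
  d_comp_d' := by
    rintro (n | n) (m | m) (k | k) _ _
    · exact A.d_comp_d _ _ _
    all_goals first | exact zero_comp | exact comp_zero

/-- The brutal truncation of a complex in negative degrees. -/
def truncNeg (A : CochainComplex E ℤ) : CochainComplex E ℤ where
  X
    | .ofNat _ => 0
    | .negSucc n => A.X (.negSucc n)
  d
    | .negSucc n, .negSucc m => A.d (.negSucc n) (.negSucc m)
    | .negSucc _, .ofNat _ => 0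
    | .ofNat _, _ => 0
  shape := by
    rintro (n | n) (m | m) h
    · rfl
    · rfl
    · rfl
    · exact A.shape _ _ h
  d_comp_d' := by
    rintro (n | n) (m | m) (k | k) _ _
    all_goals first | exact A.d_comp_d _ _ _ | exact zero_comp | exact comp_zero

lemma isZero_truncNonneg (A : CochainComplex E ℤ) (n : ℤ) (hn : n < 0) :
    IsZero ((truncNonneg A).X n) := by
  obtain n | n := n
  · exact absurd hn (by simp)
  · exact isZero_zero E

lemma isZero_truncNeg (A : CochainComplex E ℤ) (n : ℤ) (hn : 0 ≤ n) :
    IsZero ((truncNeg A).X n) := by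
  obtain n | n := n
  · exact isZero_zero E
  · exact absurd hn (by simp)

/-- The inclusion of the nonnegative part of a complex. -/
def truncNonnegι (A : CochainComplex E ℤ) : truncNonneg A ⟶ A where
  f
    | .ofNat n => 𝟙 (A.X (.ofNat n))
    | .negSucc _ => 0
  comm' := by
    rintro (n | n) (m | m) h
    · exact (Category.id_comp _).trans (Category.comp_id _).symm
    -- Differentials raise the degree, so none leaves the nonnegative part: it is a subcomplex.
    · simp at h; omega
    all_goals exact (isZero_zero E).eq_of_src _ _

/-- The projection to the negative part of a complex. -/
def truncNegπ (A : CochainComplex E ℤ) : A ⟶ truncNeg A where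
  f
    | .ofNat _ => 0
    | .negSucc n => 𝟙 (A.X (.negSucc n))
  comm' := by
    rintro (n | n) (m | m) h
    · exact (isZero_zero E).eq_of_tgt _ _
    · simp at h; omega
    · exact (isZero_zero E).eq_of_tgt _ _
    · exact (Category.id_comp _).trans (Category.comp_id _).symm

/-- The short exact sequence given by the brutal truncations. -/
def truncShortComplex (A : CochainComplex E ℤ) : ShortComplex (CochainComplex E ℤ) :=
  ShortComplex.mk (truncNonnegι A) (truncNegπ A) (by
    ext (n | n)
    · exact comp_zero
    · exact zero_comp)

/-- The truncation sequence is split in each degree. -/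
def truncSplitting (A : CochainComplex E ℤ) : ∀ n : ℤ,
    ((truncShortComplex A).map (HomologicalComplex.eval E _ n)).Splitting
  | .ofNat n =>
    { r := 𝟙 (A.X (.ofNat n))
      s := 0
      f_r := Category.id_comp _
      s_g := (isZero_zero E).eq_of_src _ _
      id := by
        have h : 𝟙 (A.X (.ofNat n)) ≫ 𝟙 (A.X (.ofNat n)) +
            (0 : A.X (.ofNat n) ⟶ (0 : E)) ≫ (0 : (0 : E) ⟶ A.X (.ofNat n)) = 𝟙 _ := by
          rw [comp_zero, add_zero, Category.comp_id]
        exact h }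
  | .negSucc n =>
    { r := 0
      s := 𝟙 (A.X (.negSucc n))
      f_r := (isZero_zero E).eq_of_src _ _
      s_g := Category.id_comp _
      id := by
        have h : (0 : A.X (.negSucc n) ⟶ (0 : E)) ≫ (0 : (0 : E) ⟶ A.X (.negSucc n)) +
            𝟙 (A.X (.negSucc n)) ≫ 𝟙 (A.X (.negSucc n)) = 𝟙 _ := by
          rw [comp_zero, zero_add, Category.comp_id]
        exact h }

end Truncation

/-! ### The Eilenberg swindle in the homotopy category. -/

section HomotopyCategory

variable {E : Type u₂} [Category.{v₂} E] [Preadditive E] [HasZeroObject E]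
  [HasBinaryBiproducts E]

/-- `B ≅ A ⊞ B⟦e⟧` gives `[B] = [A] + [B]`. -/
lemma k0Class_eq_zero_of_swindle (A : CochainComplex E ℤ) (e : ℤ)
    (he : ∀ K : KCat E, k0Class (distTriang (KCat E)) (K⟦e⟧) = k0Class (distTriang (KCat E)) K)
    (hA : ∀ n : ℤ, ∃ N : ℕ, ∀ k : ℕ, N ≤ k → IsZero (A.X (n + k * e))) :
    k0Class (distTriang (KCat E)) ((HomotopyCategory.quotient E (.up ℤ)).obj A) = 0 := by
  obtain ⟨B, ⟨i⟩⟩ := exists_iso_biprod_shift A e hA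
  let q := HomotopyCategory.quotient E (ComplexShape.up ℤ)
  have : PreservesBinaryBiproduct A (B⟦e⟧) q := preservesBinaryBiproduct_of_preservesBiproduct _ _ _
  have h := k0Class_of_iso (q.mapIso i ≪≫ q.mapBiprod A (B⟦e⟧) ≪≫
    biprod.mapIso (Iso.refl _) ((q.commShiftIso e).app B))
  rw [k0Class_biprod] at h
  change _ = _ + k0Class _ ((q.obj B)⟦e⟧) at h
  rw [he] at h
  exact right_eq_add.1 h

variable (E) in
/-- The Grothendieck group of the homotopy category of unbounded complexes vanishes. -/
theorem k0_homotopyCategory_subsingleton : Subsingleton (K0 (KCat E) (distTriang (KCat E))) := by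
  refine k0_subsingleton fun K => ?_
  let q := HomotopyCategory.quotient E (ComplexShape.up ℤ)
  obtain ⟨A, rfl⟩ : ∃ A, q.obj A = K := HomotopyCategory.quotient_obj_surjective K
  -- A degreewise split short exact sequence of complexes gives a distinguished triangle.
  have h := k0Class_eq_add
    ((HomotopyCategory.distinguished_iff_iso_trianglehOfDegreewiseSplit _).2
      ⟨_, truncSplitting A, ⟨Iso.refl _⟩⟩)
  change k0Class _ (q.obj A) = k0Class _ (q.obj (truncNonneg A)) +
    k0Class _ (q.obj (truncNeg A)) at h
  -- Each half is shifted away from degree zero, out of every fixed degree.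
  rw [h, k0Class_eq_zero_of_swindle (truncNonneg A) (-2) k0Class_shift_neg_two,
    k0Class_eq_zero_of_swindle (truncNeg A) 2 k0Class_shift_two, add_zero]
  · exact fun n => ⟨n.natAbs, fun k hk => isZero_truncNeg _ _ (by omega)⟩
  -- The `+ 1` is for `n = 0`: degree zero belongs to the nonnegative half.
  · exact fun n => ⟨n.natAbs + 1, fun k hk => isZero_truncNonneg _ _ (by omega)⟩

end HomotopyCategory

end HigherDerived

end

theorem mainTheorem3 :
    (∀ (T : Type u₁) [Category.{v₁} T] [EssentiallySmall.{w₁} T] [Preadditive T]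
      [HasZeroObject T] [HasShift T ℤ] [∀ n : ℤ, (shiftFunctor T n).Additive]
      [Pretriangulated T] [IsTriangulated T],
      Subsingleton (HigherDerived.K0Completion T) → IsIdempotentComplete T) ∧
    (∀ (E : Type u₂) [Category.{v₂} E] [EssentiallySmall.{w₂} E] [Preadditive E]
      [HasZeroObject E] [HasBinaryBiproducts E] [IsIdempotentComplete E]
      (X : HigherDerived.ExactStructure E) (w : MorphismProperty E),
      HigherDerived.IsWeakEquivalenceClass X w →
        (IsIdempotentComplete (HigherDerived.DCat X w) ↔
          Subsingleton (HigherDerived.K0Completion (HigherDerived.DCat X w)))) := by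
  refine ⟨fun T => ?_, fun E _ _ _ _ _ _ X w _ => ⟨fun _ => ?_, fun h => ?_⟩⟩
  · intros
    exact HigherDerived.isIdempotentComplete_of_k0 T ‹_›
  -- `K₀` of the quotient itself always vanishes; idempotent completeness, found as an instance,
  -- transfers this to the completion.
  · exact HigherDerived.k0Completion_subsingleton (HigherDerived.k0_verdier_subsingleton _
      (HigherDerived.k0_homotopyCategory_subsingleton E))
  · exact HigherDerived.isIdempotentComplete_of_k0 _ h
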